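/- Let $Y\subset\mathbb R$ be non-empty and closed, and let $L:Y\times\mathbb R\to[0,\infty)$ be a measurable loss that is convex in its second argument and invariant: $L(y,t)=l(y-t)$ for some $l:\mathbb R\to[0,\infty)$ with $l(0)=0$. Let $p\ge 1$ and assume that $L$ is of upper order $p$: there is $c_0>0$ with $l(r)\le c_0(|r|^p+1)$ for all $r\in\mathbb R$. Let $X$ be a topological space with its Borel $\sigma$-algebra (for instance a subset of $\mathbb R^d$), and let $H$ be the reproducing kernel Hilbert space of a bounded continuous kernel $k:X\times X\to\mathbb R$; put $\|k\|_\infty=\sup_x\sqrt{k(x,x)}$. For $q\ge 0$ and a finite signed measure $\mu$ on $X\times Y$ with total variation measure $|\mu|$, write $|\mu|_q=\int |y|^q\,d|\mu|(x,y)$ and $\|\mu\|_{\mathcal M}=|\mu|_0=|\mu|(X\times Y)$. For $\lambda>0$ and a probability measure $P$ on $X\times Y$ with $|P|_p<\infty$, the functional $f\mapsto \int L(y,f(x))\,dP(x,y)+\lambda\|f\|_H^2$ has a unique minimizer $f_{P,\lambda}$ in $H$. Moreover, there is a constant $c>0$ depending only on $L$ and $p$ such that for all probability measures $P,\tilde P$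 on $X\times Y$ with $|P|_p<\infty$ and $|\tilde P|_p<\infty$, all $\lambda>0$ and all $0<\varepsilon\le 1$: (i) $\displaystyle \|f_{(1-\varepsilon)P+\varepsilon\tilde P,\lambda}-f_{P,\lambda}\|_H\le c\,\lambda^{-1}\|k\|_\infty\,\varepsilon\Big(|P-\tilde P|_{p-1}+|P-\tilde P|_0\big(\|k\|_\infty^{p-1}\max\{1,|P|_p\}^{(p-1)/2}\lambda^{(1-p)/2}+1\big)\Big);$ if moreover $l(r)\le C|r|^p$ for some constant $C$ and all $r\in\mathbb R$, then $\max\{1,|P|_p\}$ may be replaced by $|P|_p$. (ii) If in addition $L$ is Lipschitz continuous in its second argument, uniformly in $y$, with smallest Lipschitz constant $|L|_1$, then $$\|f_{(1-\varepsilon)P+\varepsilon\tilde P,\lambda}-f_{P,\lambda}\|_H\le \lambda^{-1}\|k\|_\infty\,|L|_1\,\|P-\tilde P\|_{\mathcal M}\,\varepsilon .$$ (iii) For $\lambda>0$, $n\ge1$ and $z_i=(x_i,y_i)\in X\times Y$, the regularized empirical risk $\frac1n\sum_{i=1}^nL(y_i,f(x_i))+\lambda\|f\|_H^2$ has a unique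 minimizer $T_n(z_1,\dots,z_n)$ in $H$. If $L$ is Lipschitz continuous as in (ii), then for all $n\ge2$, all $z_1,\dots,z_{n-1}\in X\times Y$ and all $z\in X\times Y$ the sensitivity curve $SC_n(z;T_n)=n\big(T_n(z_1,\dots,z_{n-1},z)-T_{n-1}(z_1,\dots,z_{n-1})\big)$ satisfies $\|SC_n(z;T_n)\|_H\le 2\lambda^{-1}\|k\|_\infty|L|_1$. -/

import Mathlib

open MeasureTheory
open scoped ENNReal

noncomputable section

/-! ### Loss functions -/

/-- `l` represents the invariant loss `L`: `l ≥ 0`, `l 0 = 0` and `L(y, t) = l(y - t)`. -/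
def IsInvariantLoss {Y : Set ℝ} (L : Y → ℝ → ℝ) (l : ℝ → ℝ) : Prop :=
  (∀ r, 0 ≤ l r) ∧ l 0 = 0 ∧ ∀ (y : Y) (t : ℝ), L y t = l ((y : ℝ) - t)

/-- Convexity of a loss in its second argument. -/
def IsConvexLoss {Y : Set ℝ} (L : Y → ℝ → ℝ) : Prop :=
  ∀ y : Y, ConvexOn ℝ Set.univ (L y)

/-- `l` (and the invariant loss it represents) is of upper order `p`. -/
def IsUpperOrder (l : ℝ → ℝ) (p : ℝ) : Prop :=
  ∃ c : ℝ, 0 < c ∧ ∀ r : ℝ, l r ≤ c * (|r| ^ p + 1)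

/-- Lipschitz continuity of a loss in its second argument, uniformly in the first. -/
def IsLipschitzLoss {Y : Set ℝ} (L : Y → ℝ → ℝ) : Prop :=
  ∃ c : ℝ, 0 < c ∧ ∀ (y : Y) (t t' : ℝ), |L y t - L y t'| ≤ c * |t - t'|

/-- The Lipschitz constant `|L|₁`, the smallest admissible constant for a Lipschitz loss. -/
def lossLipConst {Y : Set ℝ} (L : Y → ℝ → ℝ) : ℝ :=
  sInf {c : ℝ | 0 ≤ c ∧ ∀ (y : Y) (t t' : ℝ), |L y t - L y t'| ≤ c * |t - t'|}

/-! ### Moments and total variation -/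

/-- The moment `∫ |y| ^ q dμ(x, y)` of a positive measure `μ` on `X × Y`. -/
def absMoment {X : Type*} [MeasurableSpace X] {Y : Set ℝ} (μ : Measure (X × Y)) (q : ℝ) : ℝ≥0∞ :=
  ∫⁻ z, ENNReal.ofReal (|(z.2 : ℝ)| ^ q) ∂μ

/-- The total variation measure `|P - Q|` of the signed measure `P - Q`. -/
def tvDiff {Z : Type*} [MeasurableSpace Z] (P Q : Measure Z)
    [IsFiniteMeasure P] [IsFiniteMeasure Q] : Measure Z :=
  (P.toSignedMeasure - Q.toSignedMeasure).totalVariation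

/-- The mixture `(1 - ε) P + ε Q`, for `0 ≤ ε ≤ 1`. -/
def mixture {Z : Type*} [MeasurableSpace Z] (ε : ℝ) (P Q : Measure Z) : Measure Z :=
  ENNReal.ofReal (1 - ε) • P + ENNReal.ofReal ε • Q

/-! ### The kernel of a real-valued reproducing kernel Hilbert space -/

section Kernel

variable {X : Type*} (H : Type*) [NormedAddCommGroup H] [InnerProductSpace ℝ H]
  [CompleteSpace H] [RKHS ℝ H X ℝ]

/-- The real-valued kernel `k(x, x')` of `H`. -/
def kernelFn (x x' : X) : ℝ := RKHS.kernel H x x' 1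

/-- The kernel is bounded. -/
def IsBoundedKernel : Prop := BddAbove (Set.range fun x : X => kernelFn H x x)

/-- The kernel is (jointly) continuous. -/
def IsContinuousKernel [TopologicalSpace X] : Prop :=
  Continuous fun q : X × X => kernelFn H q.1 q.2

/-- `‖k‖_∞ = sup_x √k(x, x)`. -/
def kernelSup : ℝ := ⨆ x : X, Real.sqrt (kernelFn H x x)

end Kernel

/-! ### Kernel based regression -/

section Regression

variable {X : Type*} {Y : Set ℝ} {H : Type*} [NormedAddCommGroup H] [InnerProductSpace ℝ H]
  [RKHS ℝ H X ℝ]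

/-- The regularized risk `E_P L(Y, f(X)) + lam ‖f‖²`, with values in `[0, ∞]`. -/
def regRisk [MeasurableSpace X] (L : Y → ℝ → ℝ) (P : Measure (X × Y)) (lam : ℝ) (f : H) : ℝ≥0∞ :=
  (∫⁻ z, ENNReal.ofReal (L z.2 (f z.1)) ∂P) + ENNReal.ofReal (lam * ‖f‖ ^ 2)

/-- `f` minimizes the regularized risk over `H`. -/
def IsRegMinimizer [MeasurableSpace X] (L : Y → ℝ → ℝ) (P : Measure (X × Y)) (lam : ℝ)
    (f : H) : Prop :=
  ∀ g : H, regRisk L P lam f ≤ regRisk L P lam g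

/-- The regularized empirical risk `(1/n) ∑ L(yᵢ, f(xᵢ)) + lam ‖f‖²`. -/
def empRegRisk (L : Y → ℝ → ℝ) (lam : ℝ) {n : ℕ} (D : Fin n → X × Y) (f : H) : ℝ :=
  (1 / (n : ℝ)) * ∑ i, L (D i).2 (f (D i).1) + lam * ‖f‖ ^ 2

/-- `f` minimizes the regularized empirical risk over `H`. -/
def IsEmpMinimizer (L : Y → ℝ → ℝ) (lam : ℝ) {n : ℕ} (D : Fin n → X × Y) (f : H) : Prop :=
  ∀ g : H, empRegRisk L lam D f ≤ empRegRisk L lam D g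

variable (H)

open Classical in
/-- `f_{P,lam}`: the unique minimizer of the regularized risk (and `0` if there is none). -/
def kbrSolution [MeasurableSpace X] (L : Y → ℝ → ℝ) (P : Measure (X × Y)) (lam : ℝ) : H :=
  if h : ∃! f : H, IsRegMinimizer L P lam f then h.exists.choose else 0

open Classical in
/-- The estimator `T_n`: the unique minimizer of the regularized empirical risk of a data set
(and `0` if there is none). -/
def kbrEstimator (L : Y → ℝ → ℝ) (lam : ℝ) (n : ℕ) (D : Fin n → X × Y) : H :=
  if h : ∃! f : H, IsEmpMinimizer L lam D f then h.exists.choose else 0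

end Regression

/-- The sensitivity curve at `z` of an estimator `T = (T_n)`, given data `D` of size `m = n - 1`:
`SC_n(z; T_n) = n (T_n(z_1, …, z_{n-1}, z) - T_{n-1}(z_1, …, z_{n-1}))`. -/
def sensitivityCurve {Z E : Type*} [AddCommGroup E] [Module ℝ E]
    (T : ∀ n : ℕ, (Fin n → Z) → E) {m : ℕ} (D : Fin m → Z) (z : Z) : E :=
  ((m + 1 : ℕ) : ℝ) • (T (m + 1) (Fin.snoc D z) - T m D)

end

section

open Filter Topology

/-! ### Quadratically regularized convex functionals -/

section Hilbert

variable {H : Type*} [NormedAddCommGroup H] [InnerProductSpace ℝ H]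

/-! The squared norm makes the objectives uniformly convex. Existence and uniqueness follow because
the parallelogram law forces minimizing sequences to be Cauchy
(`existsUnique_regularized_minimizer`).

For stability, let `f` minimize `R + lam ‖·‖²` and `g` minimize `Q + lam ‖·‖²` with `Q = (1 - ε) R +
ε R'`. Comparing both with `f + t (g - f)` bounds `t (1 - t) lam ‖g - f‖²` by `ε` times the
difference of the increments of `R` and `R'` along the segment (`regularized_minimizer_mixture_le`).
If that difference is at most `t ‖g - f‖ M t`, dividing by `t ‖g - f‖` and letting `t → 0` gives `‖g
- f‖ ≤ ε M 0 / lam`. The limit replaces subgradients, and `M 0` involves only the unperturbed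
minimizer `f`.

For risks, the difference of increments is an integral against `P - P'`, hence bounded by an
integral against its total variation. The integrand comes from a Lipschitz bound for `l`: the global
one for Lipschitz losses, otherwise a local one of order `ρ ^ (p - 1)` that convexity and growth
supply (`ConvexOn.abs_sub_le_of_growth`). Point evaluations are bounded by the kernel, and `lam
‖f‖²` is at most the risk of `0`. For the sensitivity curve, adding an observation is a mixture with
weight `1 / n`, which the factor `n` cancels. -/

theorem regularized_midpoint_le {R : H → ℝ} (hR : ConvexOn ℝ Set.univ R) (lam : ℝ) (f g : H) :
    R ((1 / 2 : ℝ) • f + (1 / 2 : ℝ) • g) + lam * ‖(1 / 2 : ℝ) • f + (1 / 2 : ℝ) • g‖ ^ 2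
        + lam / 4 * ‖f - g‖ ^ 2
      ≤ ((R f + lam * ‖f‖ ^ 2) + (R g + lam * ‖g‖ ^ 2)) / 2 := by
  have h := hR.2 (Set.mem_univ f) (Set.mem_univ g) (by norm_num : (0 : ℝ) ≤ 1 / 2)
    (by norm_num : (0 : ℝ) ≤ 1 / 2) (by norm_num)
  have e1 : ‖(1 / 2 : ℝ) • f + (1 / 2 : ℝ) • g‖ ^ 2 = ‖f + g‖ ^ 2 / 4 := by
    rw [← smul_add, norm_smul, mul_pow, Real.norm_eq_abs, sq_abs]; ring
  have e2 := norm_add_sq_real f g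
  have e3 := norm_sub_sq_real f g
  simp only [smul_eq_mul] at h
  rw [e1, e2, e3]
  linarith

theorem existsUnique_regularized_minimizer [CompleteSpace H] {R : H → ℝ}
    (hR : ConvexOn ℝ Set.univ R) (hcont : Continuous R) (hnonneg : ∀ f, 0 ≤ R f)
    {lam : ℝ} (hlam : 0 < lam) :
    ∃! f : H, ∀ g : H, R f + lam * ‖f‖ ^ 2 ≤ R g + lam * ‖g‖ ^ 2 := by
  set F : H → ℝ := fun f => R f + lam * ‖f‖ ^ 2 with hF
  have hFc : Continuous F := by fun_prop
  have hFb : BddBelow (Set.range F) := by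
    refine ⟨0, ?_⟩
    rintro _ ⟨f, rfl⟩
    have := hnonneg f
    simp only [hF]
    positivity
  have hmid := regularized_midpoint_le hR lam
  set m := ⨅ f, F f with hm
  have hmle : ∀ f, m ≤ F f := fun f => ciInf_le hFb f
  have hex : ∀ n : ℕ, ∃ f, F f < m + 1 / ((n : ℝ) + 1) := fun n =>
    exists_lt_of_ciInf_lt (lt_add_of_pos_right m (by positivity))
  choose u hu using hex
  have hcau : CauchySeq u := by
    rw [Metric.cauchySeq_iff']
    intro δ hδ
    obtain ⟨N, hN⟩ := exists_nat_one_div_lt (by positivity : 0 < lam / 4 * δ ^ 2)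
    refine ⟨N, fun n hn => ?_⟩
    -- The midpoint has value at least the infimum `m`, so near-minimality of both terms makes their
    -- distance small.
    have h1 := hmid (u n) (u N)
    have h2 := hmle ((1 / 2 : ℝ) • u n + (1 / 2 : ℝ) • u N)
    have h3 := hu n
    have h4 := hu N
    have h5 : 1 / ((n : ℝ) + 1) ≤ 1 / ((N : ℝ) + 1) := by gcongr
    simp only [hF] at h2 h3 h4
    have h6 : lam / 4 * ‖u n - u N‖ ^ 2 < lam / 4 * δ ^ 2 := by linarith
    rw [dist_eq_norm]
    exact lt_of_pow_lt_pow_left₀ 2 hδ.le (lt_of_mul_lt_mul_left h6 (by positivity))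
  obtain ⟨f, hf⟩ := cauchySeq_tendsto_of_complete hcau
  have hlim : Tendsto (fun n => F (u n)) atTop (𝓝 (F f)) := (hFc.tendsto f).comp hf
  have hFf : F f ≤ m := by
    have h0 : Tendsto (fun n : ℕ => m + 1 / ((n : ℝ) + 1)) atTop (𝓝 (m + 0)) :=
      tendsto_const_nhds.add tendsto_one_div_add_atTop_nhds_zero_nat
    simpa using le_of_tendsto_of_tendsto' hlim h0 fun n => (hu n).le
  refine ⟨f, fun g => hFf.trans (hmle g), fun g hg => ?_⟩
  have h1 := hmid g f
  have h2 := hmle ((1 / 2 : ℝ) • g + (1 / 2 : ℝ) • f)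
  have h3 := hg f
  simp only [hF] at h2 hFf
  have h4 : lam / 4 * ‖g - f‖ ^ 2 ≤ 0 := by linarith
  have h5 : ‖g - f‖ ^ 2 ≤ 0 := by
    by_contra! h
    have : 0 < lam / 4 * ‖g - f‖ ^ 2 := by positivity
    linarith
  have h6 : ‖g - f‖ = 0 := by
    have := sq_nonneg ‖g - f‖
    exact pow_eq_zero_iff two_ne_zero |>.1 (le_antisymm h5 this)
  exact sub_eq_zero.1 (norm_eq_zero.1 h6)

/-- Three inequalities are added: convexity of `Q` on the segment, `t` times the minimality of `g`
tested at `f`, and the minimality of `f` tested at `f + t (g - f)`. The norms combine to `t (1 - t)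
‖g - f‖²`. -/
theorem regularized_minimizer_mixture_le {R R' Q : H → ℝ} {lam ε : ℝ}
    (hQ : ∀ h, Q h = (1 - ε) * R h + ε * R' h) (hQc : ConvexOn ℝ Set.univ Q) {f g : H}
    (hf : ∀ h, R f + lam * ‖f‖ ^ 2 ≤ R h + lam * ‖h‖ ^ 2)
    (hg : ∀ h, Q g + lam * ‖g‖ ^ 2 ≤ Q h + lam * ‖h‖ ^ 2) {t : ℝ} (ht0 : 0 ≤ t) (ht1 : t ≤ 1) :
    t * ((1 - t) * (lam * ‖g - f‖ ^ 2)) ≤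
      ε * ((R (f + t • (g - f)) - R f) - (R' (f + t • (g - f)) - R' f)) := by
  have h1 := hQc.2 (Set.mem_univ f) (Set.mem_univ g) (sub_nonneg.2 ht1) ht0 (by ring)
  have e1 : (1 - t) • f + t • g = f + t • (g - f) := by module
  rw [e1] at h1
  simp only [smul_eq_mul] at h1
  have h2 := hg f
  have h3 := hf (f + t • (g - f))
  have e2 := norm_add_sq_real f (t • (g - f))
  have e3 := norm_add_sq_real f (g - f)
  rw [add_sub_cancel] at e3
  rw [inner_smul_right, norm_smul, mul_pow, Real.norm_eq_abs, sq_abs] at e2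
  have h4 := mul_le_mul_of_nonneg_left h2 ht0
  rw [e2] at h3
  rw [e3] at h4
  rw [hQ f, hQ (f + t • (g - f))] at h1
  rw [hQ f] at h4
  nlinarith

theorem norm_regularized_minimizer_mixture_sub_le {R R' Q : H → ℝ} {lam ε : ℝ} (hlam : 0 < lam)
    (hε : 0 ≤ ε) (hQ : ∀ h, Q h = (1 - ε) * R h + ε * R' h) (hQc : ConvexOn ℝ Set.univ Q)
    {f g : H} (hf : ∀ h, R f + lam * ‖f‖ ^ 2 ≤ R h + lam * ‖h‖ ^ 2)
    (hg : ∀ h, Q g + lam * ‖g‖ ^ 2 ≤ Q h + lam * ‖h‖ ^ 2) {M : ℝ → ℝ} (hM : Continuous M)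
    (hM0 : 0 ≤ M 0)
    (hb : ∀ t, 0 < t → t ≤ 1 →
      (R (f + t • (g - f)) - R f) - (R' (f + t • (g - f)) - R' f) ≤ t * ‖g - f‖ * M t) :
    ‖g - f‖ ≤ lam⁻¹ * (ε * M 0) := by
  rcases eq_or_ne (‖g - f‖) 0 with h0 | h0
  · rw [h0]; positivity
  have hpos : 0 < ‖g - f‖ := lt_of_le_of_ne (norm_nonneg _) (Ne.symm h0)
  have key : ∀ t, 0 < t → t ≤ 1 → (1 - t) * (lam * ‖g - f‖) ≤ ε * M t := by
    intro t ht ht1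
    have h1 := regularized_minimizer_mixture_le hQ hQc hf hg ht.le ht1
    have h2 := h1.trans (mul_le_mul_of_nonneg_left (hb t ht ht1) hε)
    have h3 : (t * ‖g - f‖) * ((1 - t) * (lam * ‖g - f‖)) ≤ (t * ‖g - f‖) * (ε * M t) := by
      nlinarith
    exact le_of_mul_le_mul_left h3 (by positivity)
  have hl : Tendsto (fun t : ℝ => (1 - t) * (lam * ‖g - f‖)) (𝓝[>] 0)
      (𝓝 ((1 - 0) * (lam * ‖g - f‖))) :=
    (Continuous.tendsto (by fun_prop) 0).mono_left nhdsWithin_le_nhds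
  have hr : Tendsto (fun t : ℝ => ε * M t) (𝓝[>] 0) (𝓝 (ε * M 0)) :=
    (Continuous.tendsto (by fun_prop) 0).mono_left nhdsWithin_le_nhds
  -- Letting `t → 0` removes the factor `1 - t` and leaves only the value of `M` at `f`.
  have h := le_of_tendsto_of_tendsto hl hr (by
    filter_upwards [Ioc_mem_nhdsGT (zero_lt_one' ℝ)] with t ht using key t ht.1 ht.2)
  rw [inv_mul_eq_div, le_div_iff₀ hlam]
  linarith

end Hilbert

/-! ### Convex functions of polynomial growth on the line -/

section Growth

/-- A slope of a convex function is at most its slope further out. Going a distance `ρ + 1` beyond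
the interval, nonnegativity and growth bound that slope by order `(ρ + 1) ^ p / (ρ + 1)`. -/
theorem ConvexOn.abs_sub_le_of_growth {l : ℝ → ℝ} (hl : ConvexOn ℝ Set.univ l)
    (hl0 : ∀ r, 0 ≤ l r) {p c : ℝ} (hp : 1 ≤ p) (hc : 0 ≤ c)
    (hg : ∀ r, l r ≤ c * (|r| ^ p + 1)) {ρ r r' : ℝ} (hr : |r| ≤ ρ) (hr' : |r'| ≤ ρ) :
    |l r - l r'| ≤ c * (2 ^ p + 1) * (ρ + 1) ^ (p - 1) * |r - r'| := by
  have one_side : ∀ a b : ℝ, |a| ≤ ρ → |b| ≤ ρ →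
      l a - l b ≤ c * (2 ^ p + 1) * (ρ + 1) ^ (p - 1) * |a - b| := by
    intro a b ha hb
    have hρ : 0 ≤ ρ := (abs_nonneg a).trans ha
    rcases eq_or_ne a b with rfl | hab
    · simp
    have hs : 0 < |a - b| := abs_pos.2 (sub_ne_zero.2 hab)
    set σ := ρ + 1 with hσ
    have hσ1 : 1 ≤ σ := by linarith
    have hσ0 : 0 < σ := by linarith
    -- `u` lies at distance `σ` beyond `a` on the ray from `b`, so `a` is a convex combination of
    -- `b` and `u`. As `σ ≥ 1`, the constant in the growth bound is absorbed into `σ ^ p`.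
    set u := a + σ / |a - b| * (a - b) with hu
    have hua : |u| ≤ 2 * σ := by
      have h1 : |σ / |a - b| * (a - b)| = σ := by
        rw [abs_mul, abs_div, abs_abs, div_mul_cancel₀ _ hs.ne', abs_of_pos hσ0]
      have h2 := abs_add_le a (σ / |a - b| * (a - b))
      rw [h1] at h2
      linarith
    have hlu : l u ≤ c * ((2 ^ p + 1) * (σ ^ (p - 1) * σ)) := by
      refine (hg u).trans (mul_le_mul_of_nonneg_left ?_ hc)
      have h1 : |u| ^ p ≤ (2 * σ) ^ p := by gcongr
      rw [Real.mul_rpow (by norm_num) hσ0.le] at h1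
      have h2 : σ ^ (p - 1) * σ = σ ^ p := by
        rw [← Real.rpow_add_one hσ0.ne']; simp
      have h3 : 1 ≤ σ ^ p := Real.one_le_rpow hσ1 (by linarith)
      rw [h2]
      linarith
    have hc1 := hl.2 (Set.mem_univ b) (Set.mem_univ u)
      (by positivity : 0 ≤ σ / (|a - b| + σ)) (by positivity : 0 ≤ |a - b| / (|a - b| + σ))
      (by field_simp; ring)
    have he : (σ / (|a - b| + σ)) • b + (|a - b| / (|a - b| + σ)) • u = a := by
      simp only [smul_eq_mul, hu]
      field_simp
      ring
    rw [he] at hc1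
    simp only [smul_eq_mul] at hc1
    have h4 : σ / (|a - b| + σ) = 1 - |a - b| / (|a - b| + σ) := by field_simp; ring
    rw [h4] at hc1
    have h5 : l a - l b ≤ |a - b| / (|a - b| + σ) * l u := by
      have : 0 ≤ |a - b| / (|a - b| + σ) * l b := mul_nonneg (by positivity) (hl0 b)
      linarith
    have h6 : |a - b| / (|a - b| + σ) * l u ≤ |a - b| / σ * l u :=
      mul_le_mul_of_nonneg_right (by gcongr; linarith) (hl0 u)
    have h7 : |a - b| / σ * l u ≤ |a - b| / σ * (c * ((2 ^ p + 1) * (σ ^ (p - 1) * σ))) :=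
      mul_le_mul_of_nonneg_left hlu (by positivity)
    have h8 : |a - b| / σ * (c * ((2 ^ p + 1) * (σ ^ (p - 1) * σ)))
        = c * (2 ^ p + 1) * σ ^ (p - 1) * |a - b| := by field_simp
    linarith
  rw [abs_le']
  refine ⟨one_side r r' hr hr', ?_⟩
  have := one_side r' r hr' hr
  rw [abs_sub_comm r' r] at this
  linarith

theorem Real.add_add_rpow_le {a b c q : ℝ} (ha : 0 ≤ a) (hb : 0 ≤ b) (hc : 0 ≤ c) (hq : 0 ≤ q) :
    (a + b + c) ^ q ≤ 3 ^ q * (a ^ q + b ^ q + c ^ q) := by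
  have h0 : 0 ≤ max a (max b c) := le_max_of_le_left ha
  have h1 : a + b + c ≤ 3 * max a (max b c) := by
    have := le_max_left a (max b c)
    have := (le_max_left b c).trans (le_max_right a (max b c))
    have := (le_max_right b c).trans (le_max_right a (max b c))
    linarith
  have h2 : (max a (max b c)) ^ q ≤ a ^ q + b ^ q + c ^ q := by
    have := Real.rpow_nonneg ha q
    have := Real.rpow_nonneg hb q
    have := Real.rpow_nonneg hc q
    rcases max_choice a (max b c) with h | h
    · rw [h]; linarith
    · rw [h]
      rcases max_choice b c with h | h <;> rw [h] <;> linarith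
  calc (a + b + c) ^ q ≤ (3 * max a (max b c)) ^ q := by gcongr
    _ = 3 ^ q * (max a (max b c)) ^ q := Real.mul_rpow (by norm_num) h0
    _ ≤ _ := by gcongr

end Growth

/-! ### Total variation -/

section TotalVariation

variable {Z : Type*} [MeasurableSpace Z] (P Q : Measure Z) [IsFiniteMeasure P] [IsFiniteMeasure Q]

/-- The truncated differences of measures are the Jordan parts of the signed difference. -/
theorem tvDiff_eq_sub_add_sub : tvDiff P Q = (P - Q) + (Q - P) := by
  rw [tvDiff, SignedMeasure.totalVariation, Measure.toJordanDecomposition_toSignedMeasure_sub]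
  rfl

theorem add_sub_eq_add_sub : P + (Q - P) = Q + (P - Q) := by
  have h := Measure.sub_toSignedMeasure_eq_toSignedMeasure_sub (μ := P) (ν := Q)
  rw [← Measure.toSignedMeasure_eq_toSignedMeasure_iff, Measure.toSignedMeasure_add,
    Measure.toSignedMeasure_add]
  rw [sub_eq_sub_iff_add_eq_add] at h
  rw [h, add_comm]

/-- Through this domination, integrability under `P` and `Q` passes to the total variation. -/
theorem tvDiff_le_add : tvDiff P Q ≤ P + Q := by
  rw [tvDiff_eq_sub_add_sub]
  exact add_le_add Measure.sub_le Measure.sub_le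

instance isFiniteMeasure_tvDiff : IsFiniteMeasure (tvDiff P Q) :=
  isFiniteMeasure_of_le _ (tvDiff_le_add P Q)

variable {P Q}

theorem MeasureTheory.Integrable.tvDiff {g : Z → ℝ} (hP : Integrable g P) (hQ : Integrable g Q) :
    Integrable g (tvDiff P Q) :=
  (hP.add_measure hQ).mono_measure (tvDiff_le_add P Q)

theorem integral_sub_integral_le_tvDiff {g b : Z → ℝ} (hP : Integrable g P) (hQ : Integrable g Q)
    (hb : Integrable b (tvDiff P Q)) (hgb : ∀ z, |g z| ≤ b z) :
    ∫ z, g z ∂P - ∫ z, g z ∂Q ≤ ∫ z, b z ∂(tvDiff P Q) := by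
  have h1 := congrArg (fun μ => ∫ z, g z ∂μ) (add_sub_eq_add_sub P Q)
  have hPQ : Integrable g (P - Q) := hP.mono_measure Measure.sub_le
  have hQP : Integrable g (Q - P) := hQ.mono_measure Measure.sub_le
  simp only [integral_add_measure hP hQP, integral_add_measure hQ hPQ] at h1
  have h2 : ∫ z, |g z| ∂(tvDiff P Q) ≤ ∫ z, b z ∂(tvDiff P Q) :=
    integral_mono (hP.tvDiff hQ).abs hb hgb
  rw [tvDiff_eq_sub_add_sub, integral_add_measure hPQ.abs hQP.abs, ← tvDiff_eq_sub_add_sub] at h2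
  have h3 : ∫ z, g z ∂(P - Q) ≤ ∫ z, |g z| ∂(P - Q) :=
    integral_mono hPQ hPQ.abs fun z => le_abs_self _
  have h4 : -∫ z, |g z| ∂(Q - P) ≤ ∫ z, g z ∂(Q - P) := by
    rw [← integral_neg]
    exact integral_mono hQP.abs.neg hQP fun z => neg_abs_le _
  linarith

end TotalVariation

/-! ### Point evaluations in a reproducing kernel Hilbert space -/

section Evaluation

variable {X : Type*} {H : Type*} [NormedAddCommGroup H] [InnerProductSpace ℝ H]
  [CompleteSpace H] [RKHS ℝ H X ℝ]

theorem inner_kerFun_one (f : H) (x : X) : inner ℝ f (RKHS.kerFun H x (1 : ℝ)) = f x := by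
  rw [RKHS.inner_kerFun]; simp

theorem inner_kerFun_kerFun (x x' : X) :
    inner ℝ (RKHS.kerFun H x (1 : ℝ)) (RKHS.kerFun H x' (1 : ℝ)) = kernelFn H x' x := by
  rw [inner_kerFun_one, RKHS.kerFun_apply]; rfl

theorem norm_kerFun_one (x : X) : ‖RKHS.kerFun H x (1 : ℝ)‖ = Real.sqrt (kernelFn H x x) := by
  rw [← inner_kerFun_kerFun, norm_eq_sqrt_real_inner]

variable (H) in
theorem kernelSup_nonneg : 0 ≤ kernelSup (X := X) H :=
  Real.iSup_nonneg fun _ => Real.sqrt_nonneg _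

theorem abs_apply_le_kernelSup (hk : IsBoundedKernel (X := X) H) (f : H) (x : X) :
    |f x| ≤ kernelSup (X := X) H * ‖f‖ := by
  have hb : BddAbove (Set.range fun x : X => Real.sqrt (kernelFn H x x)) := by
    obtain ⟨B, hB⟩ := hk
    refine ⟨Real.sqrt B, ?_⟩
    rintro _ ⟨x, rfl⟩
    exact Real.sqrt_le_sqrt (hB ⟨x, rfl⟩)
  rw [← inner_kerFun_one f x, mul_comm]
  refine (abs_real_inner_le_norm _ _).trans ?_
  rw [norm_kerFun_one]
  exact mul_le_mul_of_nonneg_left (le_ciSup hb x) (norm_nonneg _)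

theorem norm_kerFun_one_sub_sq (x x' : X) :
    ‖RKHS.kerFun H x (1 : ℝ) - RKHS.kerFun H x' (1 : ℝ)‖ ^ 2 =
      kernelFn H x x - 2 * kernelFn H x' x + kernelFn H x' x' := by
  have h := norm_sub_sq_real (RKHS.kerFun H x (1 : ℝ)) (RKHS.kerFun H x' (1 : ℝ))
  have h1 := real_inner_self_eq_norm_sq (RKHS.kerFun H x (1 : ℝ))
  have h2 := real_inner_self_eq_norm_sq (RKHS.kerFun H x' (1 : ℝ))
  rw [inner_kerFun_kerFun] at h h1 h2
  rw [h, ← h1, ← h2]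

/-- The squared distance between two kernel sections is a combination of kernel values that vanishes
on the diagonal. Every `f` in `H`, an inner product with these sections, is then continuous and so
measurable. -/
theorem continuous_kerFun_one [TopologicalSpace X] (hk : IsContinuousKernel (X := X) H) :
    Continuous fun x : X => RKHS.kerFun H x (1 : ℝ) := by
  have sections : ∀ K : X → X → ℝ, (Continuous fun q : X × X => K q.1 q.2) → ∀ x₀,
      (Continuous fun x => K x x) ∧ Continuous fun x => K x₀ x := fun K hK x₀ =>
    ⟨hK.comp (continuous_id.prodMk continuous_id), hK.comp (continuous_const.prodMk continuous_id)⟩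
  rw [continuous_iff_continuousAt]
  intro x₀
  obtain ⟨c1, c2⟩ := sections (kernelFn H) hk x₀
  have c3 : Continuous fun x : X =>
      Real.sqrt (kernelFn H x x - 2 * kernelFn H x₀ x + kernelFn H x₀ x₀) :=
    Real.continuous_sqrt.comp ((c1.sub (continuous_const.mul c2)).add continuous_const)
  have h0 : Real.sqrt (kernelFn H x₀ x₀ - 2 * kernelFn H x₀ x₀ + kernelFn H x₀ x₀) = 0 :=
    Real.sqrt_eq_zero'.2 (by linarith)
  have h := c3.tendsto x₀
  rw [h0] at h
  refine tendsto_iff_norm_sub_tendsto_zero.2 (h.congr fun x => ?_)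
  rw [← norm_kerFun_one_sub_sq]
  exact Real.sqrt_sq (norm_nonneg _)

theorem continuous_of_isContinuousKernel [TopologicalSpace X]
    (hk : IsContinuousKernel (X := X) H) (f : H) : Continuous fun x : X => f x :=
  (continuous_const.inner (continuous_kerFun_one hk)).congr fun x => inner_kerFun_one f x

end Evaluation

/-! ### The expected loss as a functional on the Hilbert space -/

/-- A nonnegative convex function on the line of growth order `p`, with growth constant `c`. -/
structure IsConvexOfGrowth (l : ℝ → ℝ) (p c : ℝ) : Prop where
  convexOn : ConvexOn ℝ Set.univ l
  nonneg : ∀ r, 0 ≤ l r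
  one_le : 1 ≤ p
  const_nonneg : 0 ≤ c
  growth : ∀ r, l r ≤ c * (|r| ^ p + 1)

theorem IsConvexOfGrowth.continuous {l : ℝ → ℝ} {p c : ℝ} (hl : IsConvexOfGrowth l p c) :
    Continuous l :=
  continuousOn_univ.1 (hl.convexOn.continuousOn isOpen_univ)

theorem IsConvexLoss.convexOn {Y : Set ℝ} (hY : Y.Nonempty) {L : Y → ℝ → ℝ} {l : ℝ → ℝ}
    (hinv : IsInvariantLoss L l) (hconv : IsConvexLoss L) : ConvexOn ℝ Set.univ l := by
  obtain ⟨y, hy⟩ := hY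
  have e : ∀ r, l r = L ⟨y, hy⟩ (y - r) := fun r => by rw [hinv.2.2]; simp
  refine ⟨convex_univ, fun r _ s _ a b ha hb hab => ?_⟩
  have h := (hconv ⟨y, hy⟩).2 (Set.mem_univ (y - r)) (Set.mem_univ (y - s)) ha hb hab
  rw [e, e r, e s]
  convert h using 2
  simp only [smul_eq_mul]
  linear_combination (-y) * hab

theorem IsLipschitzLoss.abs_sub_le {Y : Set ℝ} (hY : Y.Nonempty) {L : Y → ℝ → ℝ} {l : ℝ → ℝ}
    (hinv : IsInvariantLoss L l) (hLip : IsLipschitzLoss L) (r s : ℝ) :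
    |l r - l s| ≤ lossLipConst L * |r - s| := by
  obtain ⟨y, hy⟩ := hY
  rcases eq_or_ne r s with rfl | hrs
  · simp
  have hpos : 0 < |r - s| := abs_pos.2 (sub_ne_zero.2 hrs)
  rw [← div_le_iff₀ hpos]
  obtain ⟨c, hc, hcL⟩ := hLip
  -- Each admissible constant bounds the difference quotient, hence so does the infimum, which is
  -- therefore attained.
  refine le_csInf ⟨c, hc.le, hcL⟩ fun c' hc' => ?_
  rw [div_le_iff₀ hpos]
  have h := hc'.2 ⟨y, hy⟩ (y - r) (y - s)
  rw [hinv.2.2, hinv.2.2, sub_sub_cancel, sub_sub_cancel, sub_sub_sub_cancel_left,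
    abs_sub_comm s r] at h
  exact h

theorem lossLipConst_nonneg {Y : Set ℝ} (L : Y → ℝ → ℝ) : 0 ≤ lossLipConst L :=
  Real.sInf_nonneg fun _ hc => hc.1

section Risk

variable {X : Type*} {Y : Set ℝ} {H : Type*} [NormedAddCommGroup H] [InnerProductSpace ℝ H]
  [RKHS ℝ H X ℝ]

theorem convexOn_loss_eval {l : ℝ → ℝ} (hl : ConvexOn ℝ Set.univ l) (x : X) (y : ℝ) :
    ConvexOn ℝ Set.univ fun f : H => l (y - f x) := by
  refine ⟨convex_univ, fun f _ g _ a b ha hb hab => ?_⟩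
  have h := hl.2 (Set.mem_univ (y - f x)) (Set.mem_univ (y - g x)) ha hb hab
  convert h using 2
  simp only [RKHS.coe_add, RKHS.coe_smul, Pi.add_apply, Pi.smul_apply, smul_eq_mul]
  linear_combination (-y) * hab

theorem abs_loss_eval_add_smul_sub_le [CompleteSpace H] (hkb : IsBoundedKernel (X := X) H) {l : ℝ → ℝ} {B : ℝ}
    (hB : 0 ≤ B) (hLip : ∀ r s, |l r - l s| ≤ B * |r - s|) (f d : H) {t : ℝ} (ht : 0 ≤ t)
    (x : X) (y : ℝ) :
    |l (y - (f + t • d) x) - l (y - f x)| ≤ t * ‖d‖ * (B * kernelSup (X := X) H) := by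
  refine (hLip _ _).trans ?_
  have e : |y - (f + t • d) x - (y - f x)| = t * |d x| := by
    rw [RKHS.coe_add, RKHS.coe_smul, Pi.add_apply, Pi.smul_apply, smul_eq_mul,
      show y - (f x + t * d x) - (y - f x) = -(t * d x) by ring, abs_neg, abs_mul,
      abs_of_nonneg ht]
  rw [e]
  have := mul_le_mul_of_nonneg_left (abs_apply_le_kernelSup hkb d x) (by positivity : 0 ≤ B * t)
  linarith

/-- The expected invariant loss `∫ l(y - f(x)) dP(x, y)`. -/
noncomputable def expRisk [MeasurableSpace X] (l : ℝ → ℝ) (P : Measure (X × Y)) (f : H) : ℝ :=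
  ∫ z, l ((z.2 : ℝ) - f z.1) ∂P

variable [MeasurableSpace X]

theorem expRisk_nonneg {l : ℝ → ℝ} (hl : ∀ r, 0 ≤ l r) (P : Measure (X × Y)) (f : H) :
    0 ≤ expRisk l P f :=
  integral_nonneg fun _ => hl _

/-! ### Moments, mixtures and integrable growth bounds -/

theorem measurable_abs_snd_rpow (q : ℝ) : Measurable fun z : X × Y => |(z.2 : ℝ)| ^ q := by
  fun_prop

theorem integrable_abs_snd_rpow {P : Measure (X × Y)} {q : ℝ} (hP : absMoment P q ≠ ∞) :
    Integrable (fun z : X × Y => |(z.2 : ℝ)| ^ q) P := by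
  refine ⟨(measurable_abs_snd_rpow q).aestronglyMeasurable, ?_⟩
  rw [hasFiniteIntegral_iff_ofReal (Eventually.of_forall fun z => by positivity)]
  exact hP.lt_top

theorem integral_abs_snd_rpow (P : Measure (X × Y)) (q : ℝ) :
    ∫ z, |(z.2 : ℝ)| ^ q ∂P = (absMoment P q).toReal := by
  rw [integral_eq_lintegral_of_nonneg_ae (Eventually.of_forall fun z => by positivity)
    (measurable_abs_snd_rpow q).aestronglyMeasurable]
  rfl

theorem integrable_abs_snd_rpow_sub_one {P : Measure (X × Y)} [IsFiniteMeasure P] {p : ℝ}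
    (hp : 1 ≤ p) (hP : absMoment P p ≠ ∞) :
    Integrable (fun z : X × Y => |(z.2 : ℝ)| ^ (p - 1)) P := by
  refine ((integrable_abs_snd_rpow hP).add (integrable_const (1 : ℝ))).mono'
    (measurable_abs_snd_rpow _).aestronglyMeasurable (Eventually.of_forall fun z => ?_)
  rw [Real.norm_eq_abs, abs_of_nonneg (by positivity), Pi.add_apply]
  have h0 : 0 ≤ |(z.2 : ℝ)| ^ p := by positivity
  rcases le_total |(z.2 : ℝ)| 1 with h | h
  · have := Real.rpow_le_one (abs_nonneg _) h (by linarith : 0 ≤ p - 1)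
    linarith
  · have := Real.rpow_le_rpow_of_exponent_le h (by linarith : p - 1 ≤ p)
    linarith

theorem absMoment_mixture_ne_top {P P' : Measure (X × Y)} {q : ℝ} (ε : ℝ)
    (hP : absMoment P q ≠ ∞) (hP' : absMoment P' q ≠ ∞) :
    absMoment (mixture ε P P') q ≠ ∞ := by
  have h : absMoment (mixture ε P P') q =
      ENNReal.ofReal (1 - ε) * absMoment P q + ENNReal.ofReal ε * absMoment P' q := by
    simp only [absMoment, mixture, lintegral_add_measure, lintegral_smul_measure, smul_eq_mul]
  rw [h]
  exact ENNReal.add_ne_top.2 ⟨ENNReal.mul_ne_top ENNReal.ofReal_ne_top hP,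
    ENNReal.mul_ne_top ENNReal.ofReal_ne_top hP'⟩

theorem isProbabilityMeasure_mixture {Z : Type*} [MeasurableSpace Z] (P P' : Measure Z)
    [IsProbabilityMeasure P] [IsProbabilityMeasure P'] {ε : ℝ} (h0 : 0 ≤ ε) (h1 : ε ≤ 1) :
    IsProbabilityMeasure (mixture ε P P') := by
  constructor
  simp only [mixture, Measure.add_apply, Measure.smul_apply, measure_univ, smul_eq_mul, mul_one]
  rw [← ENNReal.ofReal_add (sub_nonneg.2 h1) h0]
  simp

/-- The bound depends on `u` only through `a`, so it serves as dominating function. The term `0 ^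
p`, zero since `p ≥ 1`, is the empty third slot of `Real.add_add_rpow_le`. -/
theorem growth_le_of_abs_le {l : ℝ → ℝ} {p c : ℝ} (hl : IsConvexOfGrowth l p c) {y u a : ℝ}
    (hu : |u| ≤ a) : l (y - u) ≤ c * (3 ^ p * (|y| ^ p + a ^ p + 0 ^ p) + 1) := by
  have hp : 0 ≤ p := by linarith [hl.one_le]
  refine (hl.growth _).trans (mul_le_mul_of_nonneg_left (add_le_add_left ?_ 1) hl.const_nonneg)
  have h1 : |y - u| ≤ |y| + a + 0 := by
    have := abs_sub y u
    linarith
  exact (Real.rpow_le_rpow (abs_nonneg _) h1 hp).trans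
    (Real.add_add_rpow_le (abs_nonneg _) ((abs_nonneg u).trans hu) le_rfl hp)

theorem integrable_growth_bound {P : Measure (X × Y)} [IsFiniteMeasure P]
    {p : ℝ} (hp : absMoment P p ≠ ∞) (c a : ℝ) :
    Integrable (fun z : X × Y => c * (3 ^ p * (|(z.2 : ℝ)| ^ p + a ^ p + 0 ^ p) + 1)) P :=
  (((((integrable_abs_snd_rpow hp).add (integrable_const _)).add
    (integrable_const _)).const_mul _).add (integrable_const _)).const_mul _

variable [TopologicalSpace X] [OpensMeasurableSpace X] [CompleteSpace H]

theorem aestronglyMeasurable_loss {l : ℝ → ℝ} (hl : Continuous l)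
    (hkc : IsContinuousKernel (X := X) H) (P : Measure (X × Y)) (f : H) :
    AEStronglyMeasurable (fun z : X × Y => l ((z.2 : ℝ) - f z.1)) P := by
  have h1 : Measurable fun x : X => f x := (continuous_of_isContinuousKernel hkc f).measurable
  have h2 : Measurable fun z : X × Y => (z.2 : ℝ) - f z.1 :=
    measurable_snd.subtype_val.sub (h1.comp measurable_fst)
  exact (hl.measurable.comp h2).aestronglyMeasurable

variable {l : ℝ → ℝ} {p c : ℝ}

theorem integrable_loss (hl : IsConvexOfGrowth l p c) (hkb : IsBoundedKernel (X := X) H)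
    (hkc : IsContinuousKernel (X := X) H) {P : Measure (X × Y)} [IsFiniteMeasure P]
    (hP : absMoment P p ≠ ∞) (f : H) :
    Integrable (fun z : X × Y => l ((z.2 : ℝ) - f z.1)) P := by
  refine (integrable_growth_bound hP c (kernelSup (X := X) H * ‖f‖)).mono'
    (aestronglyMeasurable_loss hl.continuous hkc P f) (Eventually.of_forall fun z => ?_)
  rw [Real.norm_eq_abs, abs_of_nonneg (hl.nonneg _)]
  exact growth_le_of_abs_le hl (abs_apply_le_kernelSup hkb f z.1)

theorem convexOn_expRisk (hl : IsConvexOfGrowth l p c) (hkb : IsBoundedKernel (X := X) H)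
    (hkc : IsContinuousKernel (X := X) H) {P : Measure (X × Y)} [IsFiniteMeasure P]
    (hP : absMoment P p ≠ ∞) : ConvexOn ℝ Set.univ fun f : H => expRisk l P f := by
  refine ⟨convex_univ, fun f _ g _ a b ha hb hab => ?_⟩
  have hi := integrable_loss hl hkb hkc hP
  simp only [expRisk, smul_eq_mul]
  rw [← integral_const_mul, ← integral_const_mul,
    ← integral_add ((hi f).const_mul a) ((hi g).const_mul b)]
  exact integral_mono (hi _) (((hi f).const_mul a).add ((hi g).const_mul b)) fun z =>
    (convexOn_loss_eval hl.convexOn z.1 (z.2 : ℝ)).2 (Set.mem_univ f) (Set.mem_univ g) ha hb hab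

theorem continuous_expRisk (hl : IsConvexOfGrowth l p c) (hkb : IsBoundedKernel (X := X) H)
    (hkc : IsContinuousKernel (X := X) H) {P : Measure (X × Y)} [IsFiniteMeasure P]
    (hP : absMoment P p ≠ ∞) : Continuous fun f : H => expRisk l P f := by
  rw [continuous_iff_continuousAt]
  intro f₀
  refine continuousAt_of_dominated
    (Eventually.of_forall fun f => aestronglyMeasurable_loss hl.continuous hkc P f) ?_
    -- On the unit ball around `f₀` all values are at most `kernelSup` times `‖f₀‖ + 1`, which gives
    -- one dominating function.
    (integrable_growth_bound hP c (kernelSup (X := X) H * (‖f₀‖ + 1)))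
    (Eventually.of_forall fun z => ?_)
  · filter_upwards [Metric.ball_mem_nhds f₀ one_pos] with f hf
    refine Eventually.of_forall fun z => ?_
    rw [Real.norm_eq_abs, abs_of_nonneg (hl.nonneg _)]
    refine growth_le_of_abs_le hl ((abs_apply_le_kernelSup hkb f z.1).trans
      (mul_le_mul_of_nonneg_left ?_ (kernelSup_nonneg H)))
    have h1 : ‖f - f₀‖ < 1 := by rwa [← dist_eq_norm]
    have h2 := norm_sub_norm_le f f₀
    linarith
  · exact (hl.continuous.comp (continuous_const.sub (RKHS.continuous_eval z.1))).continuousAt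

theorem expRisk_mixture (hl : IsConvexOfGrowth l p c) (hkb : IsBoundedKernel (X := X) H)
    (hkc : IsContinuousKernel (X := X) H) {P P' : Measure (X × Y)} [IsFiniteMeasure P]
    [IsFiniteMeasure P'] (hP : absMoment P p ≠ ∞) (hP' : absMoment P' p ≠ ∞) {ε : ℝ}
    (h0 : 0 ≤ ε) (h1 : ε ≤ 1) (f : H) :
    expRisk l (mixture ε P P') f = (1 - ε) * expRisk l P f + ε * expRisk l P' f := by
  simp only [expRisk, mixture]
  rw [integral_add_measure
    ((integrable_loss hl hkb hkc hP f).smul_measure ENNReal.ofReal_ne_top)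
    ((integrable_loss hl hkb hkc hP' f).smul_measure ENNReal.ofReal_ne_top),
    integral_smul_measure, integral_smul_measure, ENNReal.toReal_ofReal (sub_nonneg.2 h1),
    ENNReal.toReal_ofReal h0, smul_eq_mul, smul_eq_mul]

/-! ### Regularized minimizers: the moment condition makes every risk finite -/

theorem isRegMinimizer_iff {L : Y → ℝ → ℝ} (hinv : IsInvariantLoss L l)
    (hl : IsConvexOfGrowth l p c) (hkb : IsBoundedKernel (X := X) H)
    (hkc : IsContinuousKernel (X := X) H) {P : Measure (X × Y)} [IsFiniteMeasure P]
    (hP : absMoment P p ≠ ∞) {lam : ℝ} (hlam : 0 < lam) (f : H) :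
    IsRegMinimizer L P lam f ↔
      ∀ g : H, expRisk l P f + lam * ‖f‖ ^ 2 ≤ expRisk l P g + lam * ‖g‖ ^ 2 := by
  have h0 : ∀ g : H, 0 ≤ expRisk l P g + lam * ‖g‖ ^ 2 := fun g =>
    add_nonneg (expRisk_nonneg hl.nonneg P g) (by positivity)
  have e : ∀ g : H, regRisk L P lam g = ENNReal.ofReal (expRisk l P g + lam * ‖g‖ ^ 2) := by
    intro g
    rw [ENNReal.ofReal_add (expRisk_nonneg hl.nonneg P g) (by positivity), expRisk,
      ofReal_integral_eq_lintegral_ofReal (integrable_loss hl hkb hkc hP g)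
        (Eventually.of_forall fun z => hl.nonneg _)]
    simp only [regRisk, hinv.2.2]
  simp only [IsRegMinimizer, e]
  exact forall_congr' fun g => ENNReal.ofReal_le_ofReal_iff (h0 g)

theorem existsUnique_isRegMinimizer {L : Y → ℝ → ℝ} (hinv : IsInvariantLoss L l)
    (hl : IsConvexOfGrowth l p c) (hkb : IsBoundedKernel (X := X) H)
    (hkc : IsContinuousKernel (X := X) H) {P : Measure (X × Y)} [IsFiniteMeasure P]
    (hP : absMoment P p ≠ ∞) {lam : ℝ} (hlam : 0 < lam) :
    ∃! f : H, IsRegMinimizer L P lam f := by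
  simp only [isRegMinimizer_iff hinv hl hkb hkc hP hlam]
  exact existsUnique_regularized_minimizer (convexOn_expRisk hl hkb hkc hP)
    (continuous_expRisk hl hkb hkc hP) (expRisk_nonneg hl.nonneg P) hlam

theorem kbrSolution_spec {L : Y → ℝ → ℝ} (hinv : IsInvariantLoss L l)
    (hl : IsConvexOfGrowth l p c) (hkb : IsBoundedKernel (X := X) H)
    (hkc : IsContinuousKernel (X := X) H) {P : Measure (X × Y)} [IsFiniteMeasure P]
    (hP : absMoment P p ≠ ∞) {lam : ℝ} (hlam : 0 < lam) (g : H) :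
    expRisk l P (kbrSolution H L P lam) + lam * ‖kbrSolution H L P lam‖ ^ 2 ≤
      expRisk l P g + lam * ‖g‖ ^ 2 := by
  have h := existsUnique_isRegMinimizer (H := H) hinv hl hkb hkc hP hlam
  refine (isRegMinimizer_iff hinv hl hkb hkc hP hlam _).1 ?_ g
  rw [kbrSolution, dif_pos h]
  exact h.exists.choose_spec

/-- Stability of the regularized minimizer under contamination, for an arbitrary bound on the
increments of the loss along the segment between the two minimizers. -/
theorem norm_kbrSolution_mixture_sub_le {L : Y → ℝ → ℝ} (hinv : IsInvariantLoss L l)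
    (hl : IsConvexOfGrowth l p c) (hkb : IsBoundedKernel (X := X) H)
    (hkc : IsContinuousKernel (X := X) H) {P P' : Measure (X × Y)} [IsProbabilityMeasure P]
    [IsProbabilityMeasure P'] (hP : absMoment P p ≠ ∞) (hP' : absMoment P' p ≠ ∞) {lam ε : ℝ}
    (hlam : 0 < lam) (h0 : 0 ≤ ε) (h1 : ε ≤ 1) {b : ℝ → X × Y → ℝ}
    (hbi : ∀ t, Integrable (b t) (tvDiff P P'))
    (hbc : Continuous fun t => ∫ z, b t z ∂(tvDiff P P')) (hb0 : ∀ z, 0 ≤ b 0 z)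
    (hb : ∀ (d : H), d = kbrSolution H L (mixture ε P P') lam - kbrSolution H L P lam →
      ∀ t, 0 < t → t ≤ 1 → ∀ z : X × Y,
      |l ((z.2 : ℝ) - (kbrSolution H L P lam + t • d) z.1) - l ((z.2 : ℝ) - kbrSolution H L P lam z.1)|
        ≤ t * ‖d‖ * b t z) :
    ‖kbrSolution H L (mixture ε P P') lam - kbrSolution H L P lam‖ ≤
      lam⁻¹ * (ε * ∫ z, b 0 z ∂(tvDiff P P')) := by
  have := isProbabilityMeasure_mixture P P' h0 h1
  have hQ := absMoment_mixture_ne_top ε hP hP'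
  refine norm_regularized_minimizer_mixture_sub_le hlam h0
    (expRisk_mixture hl hkb hkc hP hP' h0 h1) (convexOn_expRisk hl hkb hkc hQ)
    (kbrSolution_spec hinv hl hkb hkc hP hlam) (kbrSolution_spec hinv hl hkb hkc hQ hlam) hbc
    (integral_nonneg hb0) fun t ht ht1 => ?_
  have i := integrable_loss (H := H) hl hkb hkc hP
  have i' := integrable_loss (H := H) hl hkb hkc hP'
  simp only [expRisk]
  rw [← integral_sub (i _) (i _), ← integral_sub (i' _) (i' _), ← integral_const_mul]
  exact integral_sub_integral_le_tvDiff ((i _).sub (i _)) ((i' _).sub (i' _))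
    ((hbi t).const_mul _) (hb _ rfl t ht ht1)

/-! ### Contamination bounds for Lipschitz losses and for losses of polynomial growth -/

theorem norm_kbrSolution_mixture_sub_le_of_lipschitz {L : Y → ℝ → ℝ} (hinv : IsInvariantLoss L l)
    (hl : IsConvexOfGrowth l p c) (hkb : IsBoundedKernel (X := X) H)
    (hkc : IsContinuousKernel (X := X) H) {P P' : Measure (X × Y)} [IsProbabilityMeasure P]
    [IsProbabilityMeasure P'] (hP : absMoment P p ≠ ∞) (hP' : absMoment P' p ≠ ∞) {lam ε B : ℝ}
    (hlam : 0 < lam) (h0 : 0 ≤ ε) (h1 : ε ≤ 1) (hB : 0 ≤ B)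
    (hLip : ∀ r s, |l r - l s| ≤ B * |r - s|) :
    ‖kbrSolution H L (mixture ε P P') lam - kbrSolution H L P lam‖ ≤
      lam⁻¹ * kernelSup (X := X) H * B * (tvDiff P P' Set.univ).toReal * ε := by
  have hκ := kernelSup_nonneg (X := X) H
  refine (norm_kbrSolution_mixture_sub_le hinv hl hkb hkc hP hP' hlam h0 h1
    (b := fun _ _ => B * kernelSup (X := X) H) (fun _ => integrable_const _) continuous_const
    (fun _ => by positivity) ?_).trans_eq ?_
  · intro d _ t ht _ z
    exact abs_loss_eval_add_smul_sub_le hkb hB hLip _ d ht.le z.1 z.2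
  · rw [integral_const, smul_eq_mul, measureReal_def]
    ring

theorem norm_kbrSolution_mixture_sub_le_of_growth {L : Y → ℝ → ℝ} (hinv : IsInvariantLoss L l)
    (hl : IsConvexOfGrowth l p c) (hkb : IsBoundedKernel (X := X) H)
    (hkc : IsContinuousKernel (X := X) H) {P P' : Measure (X × Y)} [IsProbabilityMeasure P]
    [IsProbabilityMeasure P'] (hP : absMoment P p ≠ ∞) (hP' : absMoment P' p ≠ ∞) {lam ε : ℝ}
    (hlam : 0 < lam) (h0 : 0 ≤ ε) (h1 : ε ≤ 1) :
    ‖kbrSolution H L (mixture ε P P') lam - kbrSolution H L P lam‖ ≤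
      lam⁻¹ * (ε * (c * (2 ^ p + 1) * 3 ^ (p - 1) * kernelSup (X := X) H *
        ((absMoment (tvDiff P P') (p - 1)).toReal + (tvDiff P P' Set.univ).toReal *
          ((kernelSup (X := X) H * ‖kbrSolution H L P lam‖) ^ (p - 1) + 1)))) := by
  have hκ := kernelSup_nonneg (X := X) H
  have hq : 0 ≤ p - 1 := by linarith [hl.one_le]
  have hc := hl.const_nonneg
  -- `A` bounds `|f x|` and `D` bounds the values of the difference of the minimizers, so residuals
  -- up to time `t` are at most `|y| + (A + t D)`. At `t = 0` the unknown `D` drops out.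
  set f := kbrSolution H L P lam
  set D := kernelSup (X := X) H * ‖kbrSolution H L (mixture ε P P') lam - f‖ with hD
  have hD0 : 0 ≤ D := by positivity
  set A := kernelSup (X := X) H * ‖f‖ with hA
  have hA0 : 0 ≤ A := by positivity
  have hm : Integrable (fun z : X × Y => |(z.2 : ℝ)| ^ (p - 1)) (tvDiff P P') :=
    (integrable_abs_snd_rpow_sub_one hl.one_le hP).tvDiff
      (integrable_abs_snd_rpow_sub_one hl.one_le hP')
  have hint : ∀ t : ℝ, ∫ z, c * (2 ^ p + 1) * 3 ^ (p - 1) * kernelSup (X := X) H *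
      (|(z.2 : ℝ)| ^ (p - 1) + ((A + t * D) ^ (p - 1) + 1)) ∂(tvDiff P P') =
      c * (2 ^ p + 1) * 3 ^ (p - 1) * kernelSup (X := X) H *
        ((absMoment (tvDiff P P') (p - 1)).toReal + (tvDiff P P' Set.univ).toReal *
          ((A + t * D) ^ (p - 1) + 1)) := by
    intro t
    rw [integral_const_mul, integral_add hm (integrable_const _), integral_abs_snd_rpow,
      integral_const, smul_eq_mul, measureReal_def]
  refine (norm_kbrSolution_mixture_sub_le hinv hl hkb hkc hP hP' hlam h0 h1
    (b := fun t z => c * (2 ^ p + 1) * 3 ^ (p - 1) * kernelSup (X := X) H *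
      (|(z.2 : ℝ)| ^ (p - 1) + ((A + t * D) ^ (p - 1) + 1)))
    (fun t => (hm.add (integrable_const _)).const_mul _) ?_ (fun z => ?_) ?_).trans_eq ?_
  · simp only [hint]
    have : Continuous fun t : ℝ => (A + t * D) ^ (p - 1) :=
      (Real.continuous_rpow_const hq).comp (by fun_prop)
    fun_prop
  · rw [zero_mul, add_zero]
    positivity
  · intro d hd t ht ht1 z
    rw [← hd] at hD
    have hfz := abs_apply_le_kernelSup hkb f z.1
    have hdz := abs_apply_le_kernelSup hkb d z.1
    rw [← hA] at hfz
    rw [← hD] at hdz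
    have e : (f + t • d) z.1 = f z.1 + t * d z.1 := by
      rw [RKHS.coe_add, RKHS.coe_smul, Pi.add_apply, Pi.smul_apply, smul_eq_mul]
    have htd : |t * d z.1| ≤ t * D := by
      rw [abs_mul, abs_of_pos ht]
      exact mul_le_mul_of_nonneg_left hdz ht.le
    have b1 : |(z.2 : ℝ) - (f + t • d) z.1| ≤ |(z.2 : ℝ)| + (A + t * D) := by
      rw [e]
      have := abs_sub (z.2 : ℝ) (f z.1 + t * d z.1)
      have := abs_add_le (f z.1) (t * d z.1)
      linarith
    have b2 : |(z.2 : ℝ) - f z.1| ≤ |(z.2 : ℝ)| + (A + t * D) := by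
      have := abs_sub (z.2 : ℝ) (f z.1)
      have : 0 ≤ t * D := by positivity
      linarith
    have b3 := hl.convexOn.abs_sub_le_of_growth hl.nonneg hl.one_le hc hl.growth b1 b2
    have b4 : |(z.2 : ℝ) - (f + t • d) z.1 - ((z.2 : ℝ) - f z.1)| ≤ t * D := by
      rw [e, show (z.2 : ℝ) - (f z.1 + t * d z.1) - ((z.2 : ℝ) - f z.1) = -(t * d z.1) by ring,
        abs_neg]
      exact htd
    have hAtD : 0 ≤ A + t * D := by positivity
    have b5 := Real.add_add_rpow_le (abs_nonneg (z.2 : ℝ)) hAtD zero_le_one hq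
    rw [Real.one_rpow, add_assoc (|(z.2 : ℝ)| ^ (p - 1))] at b5
    refine b3.trans ?_
    calc c * (2 ^ p + 1) * (|(z.2 : ℝ)| + (A + t * D) + 1) ^ (p - 1) *
          |(z.2 : ℝ) - (f + t • d) z.1 - ((z.2 : ℝ) - f z.1)|
        ≤ c * (2 ^ p + 1) *
          (3 ^ (p - 1) * (|(z.2 : ℝ)| ^ (p - 1) + ((A + t * D) ^ (p - 1) + 1))) * (t * D) := by
          gcongr
      _ = _ := by rw [hD]; ring
  · rw [hint, zero_mul, add_zero]

/-- Testing minimality at `0` gives `lam ‖f‖² ≤ C N`, which is raised to the power `(p - 1) / 2`.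
The factor `C` is to depend on the loss alone, and `N` on the moment of `P`. -/
theorem norm_kbrSolution_rpow_le {L : Y → ℝ → ℝ} (hinv : IsInvariantLoss L l)
    (hl : IsConvexOfGrowth l p c) (hkb : IsBoundedKernel (X := X) H)
    (hkc : IsContinuousKernel (X := X) H) {P : Measure (X × Y)} [IsFiniteMeasure P]
    (hP : absMoment P p ≠ ∞) {lam C N : ℝ} (hlam : 0 < lam) (hC : 0 ≤ C) (hN : 0 ≤ N)
    (hrisk : expRisk l P (0 : H) ≤ C * N) :
    (kernelSup (X := X) H * ‖kbrSolution H L P lam‖) ^ (p - 1) ≤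
      C ^ ((p - 1) / 2) * (kernelSup (X := X) H ^ (p - 1) * N ^ ((p - 1) / 2) *
        lam ^ ((1 - p) / 2)) := by
  have hq : 0 ≤ p - 1 := by linarith [hl.one_le]
  have hκ := kernelSup_nonneg (X := X) H
  have h1 := kbrSolution_spec (H := H) hinv hl hkb hkc hP hlam 0
  have h2 := expRisk_nonneg hl.nonneg P (kbrSolution H L P lam)
  rw [norm_zero, zero_pow two_ne_zero, mul_zero, add_zero] at h1
  set s := ‖kbrSolution H L P lam‖ with hs
  have hs0 : 0 ≤ s := norm_nonneg _
  have h3 : s ^ 2 ≤ C * N * lam⁻¹ := by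
    rw [← div_eq_mul_inv, le_div_iff₀ hlam]
    linarith
  have h4 : s ^ (p - 1) = (s ^ 2) ^ ((p - 1) / 2) := by
    rw [← Real.rpow_natCast, ← Real.rpow_mul hs0]
    congr 1
    push_cast
    ring
  have h5 : lam⁻¹ ^ ((p - 1) / 2) = lam ^ ((1 - p) / 2) := by
    rw [Real.inv_rpow hlam.le, ← Real.rpow_neg hlam.le]
    congr 1
    ring
  have h6 : (s ^ 2) ^ ((p - 1) / 2) ≤ (C * N * lam⁻¹) ^ ((p - 1) / 2) :=
    Real.rpow_le_rpow (by positivity) h3 (by positivity)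
  rw [Real.mul_rpow (by positivity) (by positivity), Real.mul_rpow hC hN, h5] at h6
  rw [Real.mul_rpow hκ hs0, h4]
  refine (mul_le_mul_of_nonneg_left h6 (by positivity)).trans_eq ?_
  ring

theorem norm_kbrSolution_mixture_sub_le_of_risk_le {L : Y → ℝ → ℝ} (hinv : IsInvariantLoss L l)
    (hl : IsConvexOfGrowth l p c) (hkb : IsBoundedKernel (X := X) H)
    (hkc : IsContinuousKernel (X := X) H) {P P' : Measure (X × Y)} [IsProbabilityMeasure P]
    [IsProbabilityMeasure P'] (hP : absMoment P p ≠ ∞) (hP' : absMoment P' p ≠ ∞)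
    {lam ε C N K : ℝ} (hlam : 0 < lam) (h0 : 0 ≤ ε) (h1 : ε ≤ 1) (hC : 0 ≤ C) (hN : 0 ≤ N)
    (hrisk : expRisk l P (0 : H) ≤ C * N)
    (hK : c * (2 ^ p + 1) * 3 ^ (p - 1) * (1 + C ^ ((p - 1) / 2)) ≤ K) :
    ‖kbrSolution H L (mixture ε P P') lam - kbrSolution H L P lam‖ ≤
      K * lam⁻¹ * kernelSup (X := X) H * ε *
        ((absMoment (tvDiff P P') (p - 1)).toReal +
          (tvDiff P P' Set.univ).toReal *
            (kernelSup (X := X) H ^ (p - 1) * N ^ ((p - 1) / 2) * lam ^ ((1 - p) / 2) + 1)) := by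
  have hκ := kernelSup_nonneg (X := X) H
  have hc := hl.const_nonneg
  have hr := norm_kbrSolution_rpow_le hinv hl hkb hkc hP hlam hC hN hrisk
  refine (norm_kbrSolution_mixture_sub_le_of_growth hinv hl hkb hkc hP hP' hlam h0 h1).trans ?_
  set S := kernelSup (X := X) H ^ (p - 1) * N ^ ((p - 1) / 2) * lam ^ ((1 - p) / 2) with hS
  have hS0 : 0 ≤ S := by positivity
  set M := (absMoment (tvDiff P P') (p - 1)).toReal
  have hM : 0 ≤ M := ENNReal.toReal_nonneg
  set V := (tvDiff P P' Set.univ).toReal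
  have hV : 0 ≤ V := ENNReal.toReal_nonneg
  set G := C ^ ((p - 1) / 2)
  have hG : 0 ≤ G := by positivity
  -- The factor `1 + G` moves the loss-dependent `G` out of the bracket, into the constant.
  have h2 : M + V * ((kernelSup (X := X) H * ‖kbrSolution H L P lam‖) ^ (p - 1) + 1) ≤
      (1 + G) * (M + V * (S + 1)) := by
    have h3 := mul_le_mul_of_nonneg_left hr hV
    have h4 : 0 ≤ V * S := by positivity
    have h5 : 0 ≤ G * M := by positivity
    have h6 : 0 ≤ V * G := by positivity
    nlinarith
  calc _ ≤ lam⁻¹ * (ε * (c * (2 ^ p + 1) * 3 ^ (p - 1) * kernelSup (X := X) H *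
        ((1 + G) * (M + V * (S + 1))))) := by gcongr
    _ = c * (2 ^ p + 1) * 3 ^ (p - 1) * (1 + G) *
        (lam⁻¹ * kernelSup (X := X) H * ε * (M + V * (S + 1))) := by ring
    _ ≤ K * (lam⁻¹ * kernelSup (X := X) H * ε * (M + V * (S + 1))) := by gcongr
    _ = _ := by ring

theorem expRisk_zero_le {P : Measure (X × Y)} [IsProbabilityMeasure P] {C B : ℝ}
    (hl : IsConvexOfGrowth l p c) (hkb : IsBoundedKernel (X := X) H)
    (hkc : IsContinuousKernel (X := X) H) (hP : absMoment P p ≠ ∞)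
    (hC : ∀ r, l r ≤ C * |r| ^ p + B) :
    expRisk l P (0 : H) ≤ C * (absMoment P p).toReal + B := by
  have hi : Integrable (fun z : X × Y => C * |(z.2 : ℝ)| ^ p) P :=
    (integrable_abs_snd_rpow hP).const_mul C
  have h := integral_mono (integrable_loss hl hkb hkc hP (0 : H)) (hi.add (integrable_const B))
    fun z => by simpa using hC (z.2 : ℝ)
  refine h.trans_eq ?_
  rw [integral_add' hi (integrable_const B), integral_const_mul, integral_abs_snd_rpow]
  simp

end Risk

/-! ### Empirical risk -/

section Empirical

variable {X : Type*} {Y : Set ℝ} {H : Type*} [NormedAddCommGroup H] [InnerProductSpace ℝ H]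
  [RKHS ℝ H X ℝ]

/-- The empirical mean loss of `f` on a data set. -/
noncomputable def empLoss (l : ℝ → ℝ) {n : ℕ} (D : Fin n → X × Y) (f : H) : ℝ :=
  (1 / (n : ℝ)) * ∑ i, l (((D i).2 : ℝ) - f (D i).1)

theorem empLoss_nonneg {l : ℝ → ℝ} (hl : ∀ r, 0 ≤ l r) {n : ℕ} (D : Fin n → X × Y) (f : H) :
    0 ≤ empLoss l D f :=
  mul_nonneg (by positivity) (Finset.sum_nonneg fun _ _ => hl _)

theorem convexOn_empLoss {l : ℝ → ℝ} (hl : ConvexOn ℝ Set.univ l) {n : ℕ} (D : Fin n → X × Y) :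
    ConvexOn ℝ Set.univ fun f : H => empLoss l D f := by
  have h : ConvexOn ℝ Set.univ fun f : H => ∑ i, l (((D i).2 : ℝ) - f (D i).1) := by
    refine ⟨convex_univ, fun f _ g _ a b ha hb hab => ?_⟩
    rw [smul_eq_mul, smul_eq_mul, Finset.mul_sum, Finset.mul_sum, ← Finset.sum_add_distrib]
    exact Finset.sum_le_sum fun i _ =>
      (convexOn_loss_eval hl (D i).1 ((D i).2 : ℝ)).2 (Set.mem_univ f) (Set.mem_univ g) ha hb hab
  exact h.smul (by positivity)

theorem continuous_empLoss {l : ℝ → ℝ} (hl : Continuous l) {n : ℕ} (D : Fin n → X × Y) :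
    Continuous fun f : H => empLoss l D f :=
  continuous_const.mul (continuous_finsetSum _ fun i _ =>
    hl.comp (continuous_const.sub (RKHS.continuous_eval (D i).1)))

/-- This is the mixture form needed for the Hilbert space stability lemma, with `ε = 1 / (m + 1)`
and the loss at `z` as second functional. -/
theorem empLoss_snoc (l : ℝ → ℝ) {m : ℕ} (hm : 1 ≤ m) (D : Fin m → X × Y) (z : X × Y) (f : H) :
    empLoss l (Fin.snoc D z : Fin (m + 1) → X × Y) f =
      (1 - 1 / ((m + 1 : ℕ) : ℝ)) * empLoss l D f +
        1 / ((m + 1 : ℕ) : ℝ) * l ((z.2 : ℝ) - f z.1) := by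
  have hm' : (m : ℝ) ≠ 0 := by positivity
  simp only [empLoss, Fin.sum_univ_castSucc, Fin.snoc_castSucc, Fin.snoc_last]
  push_cast
  field_simp
  ring

theorem isEmpMinimizer_iff {L : Y → ℝ → ℝ} {l : ℝ → ℝ} (hinv : IsInvariantLoss L l) (lam : ℝ)
    {n : ℕ} (D : Fin n → X × Y) (f : H) :
    IsEmpMinimizer L lam D f ↔
      ∀ g : H, empLoss l D f + lam * ‖f‖ ^ 2 ≤ empLoss l D g + lam * ‖g‖ ^ 2 := by
  simp only [IsEmpMinimizer, empRegRisk, empLoss, hinv.2.2]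

variable [CompleteSpace H]

theorem existsUnique_isEmpMinimizer {L : Y → ℝ → ℝ} {l : ℝ → ℝ} {p c : ℝ}
    (hinv : IsInvariantLoss L l) (hl : IsConvexOfGrowth l p c) {lam : ℝ} (hlam : 0 < lam) {n : ℕ}
    (D : Fin n → X × Y) : ∃! f : H, IsEmpMinimizer L lam D f := by
  simp only [isEmpMinimizer_iff hinv]
  exact existsUnique_regularized_minimizer (convexOn_empLoss hl.convexOn D)
    (continuous_empLoss hl.continuous D) (empLoss_nonneg hl.nonneg D) hlam

theorem kbrEstimator_spec {L : Y → ℝ → ℝ} {l : ℝ → ℝ} {p c : ℝ}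
    (hinv : IsInvariantLoss L l) (hl : IsConvexOfGrowth l p c) {lam : ℝ} (hlam : 0 < lam) {n : ℕ}
    (D : Fin n → X × Y) (g : H) :
    empLoss l D (kbrEstimator H L lam n D) + lam * ‖kbrEstimator H L lam n D‖ ^ 2 ≤
      empLoss l D g + lam * ‖g‖ ^ 2 := by
  have h := existsUnique_isEmpMinimizer (H := H) hinv hl hlam D
  refine (isEmpMinimizer_iff hinv lam D _).1 ?_ g
  rw [kbrEstimator, dif_pos h]
  exact h.exists.choose_spec

theorem norm_sensitivityCurve_kbrEstimator_le {L : Y → ℝ → ℝ} {l : ℝ → ℝ} {p c : ℝ}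
    (hinv : IsInvariantLoss L l) (hl : IsConvexOfGrowth l p c)
    (hkb : IsBoundedKernel (X := X) H) {B : ℝ} (hB : 0 ≤ B)
    (hLip : ∀ r s, |l r - l s| ≤ B * |r - s|) {lam : ℝ} (hlam : 0 < lam) {m : ℕ} (hm : 1 ≤ m)
    (D : Fin m → X × Y) (z : X × Y) :
    ‖sensitivityCurve (kbrEstimator H L lam) D z‖ ≤ 2 * lam⁻¹ * kernelSup (X := X) H * B := by
  have hκ := kernelSup_nonneg (X := X) H
  have key : ‖kbrEstimator H L lam (m + 1) (Fin.snoc D z) - kbrEstimator H L lam m D‖ ≤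
      lam⁻¹ * (1 / ((m + 1 : ℕ) : ℝ) * (2 * (B * kernelSup (X := X) H))) := by
    refine norm_regularized_minimizer_mixture_sub_le hlam (by positivity)
      (empLoss_snoc l hm D z)
      (convexOn_empLoss hl.convexOn (Fin.snoc D z : Fin (m + 1) → X × Y))
      (kbrEstimator_spec hinv hl hlam D) (kbrEstimator_spec hinv hl hlam _)
      -- The increments of the old mean loss and of the loss at `z` each contribute `B * kernelSup`,
      -- whence the factor 2.
      (M := fun _ => 2 * (B * kernelSup (X := X) H)) continuous_const (by positivity)
      fun t ht _ => ?_
    set f := kbrEstimator H L lam m D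
    set d := kbrEstimator H L lam (m + 1) (Fin.snoc D z) - f
    have hb := abs_loss_eval_add_smul_sub_le hkb hB hLip f d ht.le
    have h1 : empLoss l D (f + t • d) - empLoss l D f ≤
        t * ‖d‖ * (B * kernelSup (X := X) H) := by
      have hm' : (0 : ℝ) < m := by exact_mod_cast hm
      have hs : ∑ i, (l (((D i).2 : ℝ) - (f + t • d) (D i).1) - l (((D i).2 : ℝ) - f (D i).1)) ≤
          ∑ _i : Fin m, t * ‖d‖ * (B * kernelSup (X := X) H) :=
        Finset.sum_le_sum fun i _ => (le_abs_self _).trans (hb _ _)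
      rw [Finset.sum_const, Finset.card_univ, Fintype.card_fin, nsmul_eq_mul] at hs
      rw [empLoss, empLoss, ← mul_sub, ← Finset.sum_sub_distrib, one_div_mul_eq_div,
        div_le_iff₀ hm']
      linarith
    have h2 := (abs_le.1 (hb z.1 z.2)).1
    linarith
  rw [sensitivityCurve, norm_smul, Real.norm_eq_abs, abs_of_nonneg (by positivity)]
  refine (mul_le_mul_of_nonneg_left key (by positivity)).trans_eq ?_
  field_simp

end Empirical

end

/-! ### Choice of the constant and assembly -/

theorem theorem17
    (Y : Set ℝ) (hYne : Y.Nonempty) (hYcl : IsClosed Y)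
    (L : Y → ℝ → ℝ) (l : ℝ → ℝ)
    (hLmeas : Measurable (Function.uncurry L))
    (hLinv : IsInvariantLoss L l) (hLconv : IsConvexLoss L)
    (p : ℝ) (hp : 1 ≤ p) (hLup : IsUpperOrder l p) :
    ∃ c : ℝ, 0 < c ∧
      ∀ (X : Type*) [TopologicalSpace X] [MeasurableSpace X] [BorelSpace X]
        (H : Type*) [NormedAddCommGroup H] [InnerProductSpace ℝ H] [CompleteSpace H]
        [RKHS ℝ H X ℝ],
        IsBoundedKernel (X := X) H → IsContinuousKernel (X := X) H →
        -- the minimizers exist and are unique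
        (∀ (P : Measure (X × Y)) [IsProbabilityMeasure P], absMoment P p ≠ ∞ →
          ∀ lam : ℝ, 0 < lam → ∃! f : H, IsRegMinimizer L P lam f) ∧
        (∀ lam : ℝ, 0 < lam → ∀ n : ℕ, 1 ≤ n → ∀ D : Fin n → X × Y,
          ∃! f : H, IsEmpMinimizer L lam D f) ∧
        -- bounds under contamination
        (∀ (P P' : Measure (X × Y)) [IsProbabilityMeasure P] [IsProbabilityMeasure P'],
          absMoment P p ≠ ∞ → absMoment P' p ≠ ∞ →
          ∀ lam ε : ℝ, 0 < lam → 0 < ε → ε ≤ 1 →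
            ‖kbrSolution H L (mixture ε P P') lam - kbrSolution H L P lam‖ ≤
                c * lam⁻¹ * kernelSup H * ε *
                  ((absMoment (tvDiff P P') (p - 1)).toReal +
                    (tvDiff P P' Set.univ).toReal *
                      (kernelSup H ^ (p - 1) * (max 1 (absMoment P p).toReal) ^ ((p - 1) / 2) *
                        lam ^ ((1 - p) / 2) + 1)) ∧
            ((∃ C : ℝ, ∀ r : ℝ, l r ≤ C * |r| ^ p) →
              ‖kbrSolution H L (mixture ε P P') lam - kbrSolution H L P lam‖ ≤
                c * lam⁻¹ * kernelSup H * ε *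
                  ((absMoment (tvDiff P P') (p - 1)).toReal +
                    (tvDiff P P' Set.univ).toReal *
                      (kernelSup H ^ (p - 1) * (absMoment P p).toReal ^ ((p - 1) / 2) *
                        lam ^ ((1 - p) / 2) + 1))) ∧
            (IsLipschitzLoss L →
              ‖kbrSolution H L (mixture ε P P') lam - kbrSolution H L P lam‖ ≤
                lam⁻¹ * kernelSup H * lossLipConst L * (tvDiff P P' Set.univ).toReal * ε)) ∧
        -- the sensitivity curve is uniformly bounded
        (IsLipschitzLoss L →
          ∀ lam : ℝ, 0 < lam → ∀ m : ℕ, 1 ≤ m → ∀ (D : Fin m → X × Y) (z : X × Y),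
            ‖sensitivityCurve (kbrEstimator H L lam) D z‖ ≤
              2 * lam⁻¹ * kernelSup H * lossLipConst L) := by
  obtain ⟨c₀, hc₀, hgrowth⟩ := hLup
  have hl : IsConvexOfGrowth l p c₀ :=
    ⟨hLconv.convexOn hYne hLinv, hLinv.1, hp, hc₀.le, hgrowth⟩
  -- `C` is fixed before the space, kernel and measures, so that the final constant depends only on
  -- the loss and `p`; it defaults to `0` if no pure power bound exists.
  obtain ⟨C, hC0, hC⟩ : ∃ C : ℝ, 0 ≤ C ∧
      ((∃ C' : ℝ, ∀ r : ℝ, l r ≤ C' * |r| ^ p) → ∀ r : ℝ, l r ≤ C * |r| ^ p) := by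
    by_cases h : ∃ C' : ℝ, ∀ r : ℝ, l r ≤ C' * |r| ^ p
    · obtain ⟨C', hC'⟩ := h
      exact ⟨max C' 0, le_max_right _ _, fun _ r => (hC' r).trans
        (mul_le_mul_of_nonneg_right (le_max_left _ _) (by positivity))⟩
    · exact ⟨0, le_rfl, fun h' => absurd h' h⟩
  have hLip := IsLipschitzLoss.abs_sub_le hYne hLinv
  have hB := lossLipConst_nonneg L
  -- The sum covers both moment bounds: `2 * c₀` comes from `c₀ (|P|_p + 1) ≤ 2 c₀ max 1 |P|_p`, and
  -- `C` from the pure power case.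
  refine ⟨c₀ * (2 ^ p + 1) * 3 ^ (p - 1) * (1 + (2 * c₀) ^ ((p - 1) / 2) + C ^ ((p - 1) / 2)),
    by positivity, ?_⟩
  intro X _ _ _ H _ _ _ _ hkb hkc
  refine ⟨fun P _ hP lam hlam => existsUnique_isRegMinimizer hLinv hl hkb hkc hP hlam,
    fun lam hlam n _ D => existsUnique_isEmpMinimizer hLinv hl hlam D,
    fun P P' _ _ hP hP' lam ε hlam hε hε1 => ⟨?_, fun hCex => ?_, fun hLipL => ?_⟩,
    fun hLipL lam hlam m hm D z =>
      norm_sensitivityCurve_kbrEstimator_le hLinv hl hkb hB (hLip hLipL) hlam hm D z⟩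
  · refine norm_kbrSolution_mixture_sub_le_of_risk_le hLinv hl hkb hkc hP hP' hlam hε.le hε1
      (C := 2 * c₀) (by positivity) (by positivity) ?_ ?_
    · refine (expRisk_zero_le hl hkb hkc hP (C := c₀) (B := c₀) fun r => ?_).trans ?_
      · linarith [hgrowth r]
      · nlinarith [le_max_left 1 (absMoment P p).toReal, le_max_right 1 (absMoment P p).toReal]
    · refine mul_le_mul_of_nonneg_left ?_ (by positivity)
      have : 0 ≤ C ^ ((p - 1) / 2) := by positivity
      linarith
  · refine norm_kbrSolution_mixture_sub_le_of_risk_le hLinv hl hkb hkc hP hP' hlam hε.le hε1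
      hC0 ENNReal.toReal_nonneg ?_ ?_
    · simpa using expRisk_zero_le hl hkb hkc hP (C := C) (B := 0)
        fun r => by simpa using hC hCex r
    · refine mul_le_mul_of_nonneg_left ?_ (by positivity)
      have : 0 ≤ (2 * c₀) ^ ((p - 1) / 2) := by positivity
      linarith
  · exact norm_kbrSolution_mixture_sub_le_of_lipschitz hLinv hl hkb hkc hP hP' hlam hε.le hε1 hB
      (hLip hLipL)
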